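/- Let $X$ be a finite set, let $\Bbbk$ be a field, and let $C$ be a clutter with vertex set $X$, that is, a family $E(C)$ of subsets of $X$ (edges), none of which is included in another. Let $I(C)\subseteq \Bbbk[X]$ be the edge ideal of $C$, generated by the monomials $\prod_{x\in e}x$ with $e\in E(C)$. A vertex cover of $C$ is a subset of $X$ that meets every edge; let $W_1,\dots,W_n$ be the distinct minimal (under inclusion) vertex covers of $C$. Let $s\ge 0$ be an integer. For $W\subseteq X$ put $\mathcal J_s(W)=\bigcup_{x\in W}\{x_0,\dots,x_s\}$, and let $\langle \mathcal J_s(W)\rangle$ be the ideal of $\Bbbk[\mathcal J_s(X)]$ generated by these variables. For an ideal $I$ of $\Bbbk[X]$, the ideal of $s$-jets $\mathcal J_s(I)\subseteq\Bbbk[\mathcal J_s(X)]$ is generated by the polynomials $f_0,\dots,f_s$ with $f\in I$, where $f_j$ is the coefficient of $t^j$ in the image of $f$ under the $\Bbbk$-algebra homomorphism $\Bbbk[X]\to\Bbbk[\mathcal J_s(X)][t]/\langle t^{s+1}\rangle$ sending $x\mapsto\sum_{j=0}^s x_jt^j$. Let $Z\subseteq\mathbb A^{X}_{\Bbbk}=\operatorname{Spec}\Bbbk[X]$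 be the vanishing locus of $I$ with its reduced structure, let $Z_{\mathrm{sing}}$ be the complement in $Z$ of its smooth locus over $\Bbbk$, let $\mathcal J_s(Z)\subseteq\operatorname{Spec}\Bbbk[\mathcal J_s(X)]$ be the vanishing locus of the ideal of $s$-jets of $\sqrt I$, and let $\pi_s\colon\operatorname{Spec}\Bbbk[\mathcal J_s(X)]\to\operatorname{Spec}\Bbbk[X]$ be the projection induced by $x\mapsto x_0$. The ideal of principal $s$-jets of $I$ is $$\mathcal P_s(I)=\mathbb I\left(\overline{\mathcal J_s(Z)\setminus\pi_s^{-1}(Z_{\mathrm{sing}})}\right)\subseteq\Bbbk[\mathcal J_s(X)],$$ the ideal of polynomials vanishing on the Zariski closure of the set of $s$-jets of $Z$ supported over the smooth locus of $Z$. Then, for every $s\ge 0$, $$\mathcal P_s(I(C))=\bigcap_{k=1}^n\langle\mathcal J_s(W_k)\rangle,$$ the ideals $\langle\mathcal J_s(W_1)\rangle,\dots,\langle\mathcal J_s(W_n)\rangle$ are distinct, and this is the irredundant primary decomposition of $\mathcal P_s(I(C))$: these ideals are primary with distinct radicals, none of them contains the intersection of the others, and every primary decomposition of $\mathcal P_s(I(C))$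 into finitely many primary ideals with these two properties consists of exactly these ideals. (An empty intersection is the whole ring.) -/

import Mathlib

/-- A clutter with vertex set `X`: a family of subsets of `X` (the edges), none of which is
included in another. -/
structure Clutter (X : Type*) where
  /-- The edges. -/
  edges : Set (Finset X)
  /-- No edge is included in another edge. -/
  isAntichain : IsAntichain (· ⊆ ·) edges

namespace Clutter

variable {X : Type*}

/-- The edge ideal `I(C)` of `k[X]`: it is generated by the products of the vertices of an edge,
over all edges. -/
noncomputable def edgeIdeal (k : Type*) [Field k] (C : Clutter X) : Ideal (MvPolynomial X k) :=
  Ideal.span ((fun e : Finset X => ∏ x ∈ e, MvPolynomial.X x) '' C.edges)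

/-- A vertex cover: every edge contains at least one vertex of `W`. -/
def IsVertexCover (C : Clutter X) (W : Set X) : Prop :=
  ∀ e ∈ C.edges, ∃ x ∈ e, x ∈ W

/-- A minimal vertex cover: no proper subset is a vertex cover. -/
def IsMinimalVertexCover (C : Clutter X) (W : Set X) : Prop :=
  Minimal C.IsVertexCover W

end Clutter

namespace Jets

/-- For a set of variables `X`, the set `J_s(X)` of jet variables `x_0, …, x_s` with `x` in `X`;
the variable `x_j` is the pair `(x, j)`. -/
abbrev JetVar (X : Type*) (s : ℕ) : Type _ := X × Fin (s + 1)

/-- For a subset `W` of `X`, the subset `J_s(W)` of `J_s(X)`. -/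
def jetSet {X : Type*} (s : ℕ) (W : Set X) : Set (JetVar X s) := {v | v.1 ∈ W}

variable {X : Type*} {k : Type*} [Field k]

/-- The ideal of `k[X]` generated by a set of variables. -/
noncomputable def varIdeal {Y : Type*} (k : Type*) [Field k] (V : Set Y) :
    Ideal (MvPolynomial Y k) :=
  Ideal.span (MvPolynomial.X '' V)

/-- The homomorphism `k[X] → k[J_s(X)][t]` with `x ↦ x_0 + x_1 t + ⋯ + x_s t ^ s`.
Followed by reduction modulo `t ^ (s + 1)` it is `φ_s`. -/
noncomputable def jetHom (s : ℕ) :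
    MvPolynomial X k →ₐ[k] Polynomial (MvPolynomial (JetVar X s) k) :=
  MvPolynomial.aeval fun x =>
    ∑ j : Fin (s + 1), Polynomial.C (MvPolynomial.X (x, j)) * Polynomial.X ^ (j : ℕ)

/-- The polynomial `f_j`, for `j ≤ s`, in `φ_s(f) = f_0 + f_1 t + ⋯ + f_s t ^ s` modulo
`t ^ (s + 1)`. -/
noncomputable def jetCoeff (s : ℕ) (f : MvPolynomial X k) (j : Fin (s + 1)) :
    MvPolynomial (JetVar X s) k :=
  (jetHom s f).coeff j

/-- The ideal of `s`-jets of `I`, generated by the polynomials `f_0, …, f_s` with `f` in `I`.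
By `jetIdeal_span`, it is enough to let `f` run over a set of generators of `I`. -/
noncomputable def jetIdeal (s : ℕ) (I : Ideal (MvPolynomial X k)) :
    Ideal (MvPolynomial (JetVar X s) k) :=
  Ideal.span {g | ∃ f ∈ I, ∃ j, g = jetCoeff s f j}

/-- The ideal of `s`-jets is generated by the polynomials `f_j` for `f` in any generating set. -/
theorem jetIdeal_span (s : ℕ) (S : Set (MvPolynomial X k)) :
    jetIdeal s (Ideal.span S) = Ideal.span {g | ∃ f ∈ S, ∃ j, g = jetCoeff s f j} := by
  apply le_antisymm
  · refine Ideal.span_le.2 ?_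
    rintro _ ⟨f, hf, j, rfl⟩
    simp only [SetLike.mem_coe]
    revert j
    refine Submodule.span_induction (p := fun f _ => ∀ j : Fin (s + 1), jetCoeff s f j ∈
      Ideal.span {g | ∃ f ∈ S, ∃ j, g = jetCoeff s f j}) ?_ ?_ ?_ ?_ hf
    · exact fun f hf j => Ideal.subset_span ⟨f, hf, j, rfl⟩
    · intro j
      simp [jetCoeff]
    · intro f g _ _ h1 h2 j
      have := Ideal.add_mem _ (h1 j) (h2 j)
      simpa [jetCoeff] using this
    · intro a f _ h j
      simp only [jetCoeff, smul_eq_mul, map_mul, Polynomial.coeff_mul]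
      refine Ideal.sum_mem _ fun p hp => Ideal.mul_mem_left _ _ ?_
      have hp' := Finset.HasAntidiagonal.mem_antidiagonal.1 hp
      have hj := j.2
      exact h ⟨p.2, by omega⟩
  · refine Ideal.span_mono ?_
    rintro _ ⟨f, hf, j, rfl⟩
    exact ⟨f, Ideal.subset_span hf, j, rfl⟩

/-- The inclusion `k[X] → k[J_s(X)]` with `x ↦ x_0`. -/
noncomputable def jetIncl (s : ℕ) : MvPolynomial X k →ₐ[k] MvPolynomial (JetVar X s) k :=
  MvPolynomial.rename fun x => (x, 0)

/-- The projection `π_s` from the `s`-jets of affine space, `Spec k[J_s(X)]`, to affine space,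
`Spec k[X]`. -/
noncomputable def jetProj (s : ℕ) :
    PrimeSpectrum (MvPolynomial (JetVar X s) k) → PrimeSpectrum (MvPolynomial X k) :=
  PrimeSpectrum.comap (jetIncl s).toRingHom

/-- The `s`-jets of a Zariski closed subset `Z` of `Spec k[X]`, where `Z` has its reduced
structure: the vanishing locus of the ideal of `s`-jets of the ideal of `Z`. -/
noncomputable def jetLocus (s : ℕ) (Z : Set (PrimeSpectrum (MvPolynomial X k))) :
    Set (PrimeSpectrum (MvPolynomial (JetVar X s) k)) :=
  PrimeSpectrum.zeroLocus (jetIdeal s (PrimeSpectrum.vanishingIdeal Z))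

/-- The smooth locus over `k` of the closed subscheme `Spec (k[X] / I)` of `Spec k[X]`, as a set of
points of `Spec k[X]`. -/
def smoothPoints (I : Ideal (MvPolynomial X k)) : Set (PrimeSpectrum (MvPolynomial X k)) :=
  PrimeSpectrum.comap (Ideal.Quotient.mk I) '' Algebra.smoothLocus k (MvPolynomial X k ⧸ I)

/-- The singular locus of a Zariski closed subset `Z` of `Spec k[X]`: the points of `Z` that
do not belong to the smooth locus over `k` of `Z`, where `Z` has its reduced structure. -/
def singularLocus (Z : Set (PrimeSpectrum (MvPolynomial X k))) :
    Set (PrimeSpectrum (MvPolynomial X k)) :=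
  Z \ smoothPoints (PrimeSpectrum.vanishingIdeal Z)

/-- The ideal of principal `s`-jets of `I`: the polynomials that vanish on the Zariski closure of
the set of `s`-jets of `Z` not supported over the singular locus of `Z`, where `Z` is the vanishing
locus of `I`. -/
noncomputable def principalJetIdeal (s : ℕ) (I : Ideal (MvPolynomial X k)) :
    Ideal (MvPolynomial (JetVar X s) k) :=
  PrimeSpectrum.vanishingIdeal (closure
    (jetLocus s (PrimeSpectrum.zeroLocus (I : Set (MvPolynomial X k))) \
      jetProj s ⁻¹' singularLocus (PrimeSpectrum.zeroLocus (I : Set (MvPolynomial X k)))))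

end Jets

-- The ideal of principal jets is the intersection of the primes `q` in the jet locus lying over
-- smooth points of the zero locus `Z` of the edge ideal.
--
-- If `W` is a minimal cover, the prime of `J_s(W)` is itself such a `q`: it lies over the generic
-- point of the coordinate subspace of `W`, which is smooth because each variable of `W` is killed
-- there by a unit (`varIdeal_mem_smoothPoints`).
--
-- Conversely, let `q` lie over a smooth point `p`, and let `V` be the set of vertices in `p`.
-- Smoothness forces every inclusion-minimal trace of an edge on `V` to be a singleton
-- (`card_le_one_of_mem_smoothPoints`): if such a trace had `d ≥ 2` elements, sending them all to
-- `t` would give a point of `Z` modulo `t ^ d` that does not lift modulo `t ^ (d + 1)`. The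
-- singleton traces form a minimal cover `W`. For `x` in `W` some edge monomial is `x * g` with `g`
-- a unit at `p`, so its jets force every `x_j` into `q` (`X_mem_of_jetCoeff_mem`).
--
-- The primes obtained are incomparable, which gives irredundancy and uniqueness.

universe u v

section

open MvPolynomial

/-! ### Ideals generated by variables, and jets of products. -/

namespace Jets

variable {σ : Type*} {k : Type*} [Field k]

open Classical in
/-- An ideal generated by variables is the kernel of the substitution of zero for them. -/
theorem varIdeal_eq_ker {Y : Type*} (V : Set Y) :
    varIdeal k V = RingHom.ker (aeval (R := k) fun y => if y ∈ V then 0 else X y :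
      MvPolynomial Y k →ₐ[k] MvPolynomial Y k) := by
  apply le_antisymm
  · refine Ideal.span_le.2 ?_
    rintro _ ⟨y, hy, rfl⟩
    simp [hy]
  · intro f hf
    have key : (Ideal.Quotient.mkₐ k (varIdeal k V)).comp
        (aeval (R := k) fun y => if y ∈ V then 0 else X y) =
          Ideal.Quotient.mkₐ k (varIdeal k V) := by
      refine algHom_ext fun y => ?_
      by_cases hy : y ∈ V
      · have : Ideal.Quotient.mk (varIdeal k V) (X y) = 0 :=
          Ideal.Quotient.eq_zero_iff_mem.2 (Ideal.subset_span ⟨y, hy, rfl⟩)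
        simp [hy, this]
      · simp [hy]
    have h := DFunLike.congr_fun key f
    rw [AlgHom.comp_apply, (RingHom.mem_ker).1 hf, map_zero] at h
    exact Ideal.Quotient.eq_zero_iff_mem.1 h.symm

instance varIdeal_isPrime {Y : Type*} (V : Set Y) : (varIdeal k V).IsPrime := by
  rw [varIdeal_eq_ker]
  exact RingHom.ker_isPrime _

theorem X_mem_varIdeal {Y : Type*} {V : Set Y} {y : Y} :
    (X y : MvPolynomial Y k) ∈ varIdeal k V ↔ y ∈ V := by
  classical
  rw [varIdeal_eq_ker, RingHom.mem_ker]
  by_cases hy : y ∈ V <;> simp [hy]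

theorem varIdeal_le_iff {Y : Type*} {V : Set Y} {I : Ideal (MvPolynomial Y k)} :
    varIdeal k V ≤ I ↔ ∀ y ∈ V, X y ∈ I := by
  simp [varIdeal, Ideal.span_le, Set.subset_def]

theorem prime_X {Y : Type*} (y : Y) : Prime (X y : MvPolynomial Y k) := by
  rw [← Ideal.span_singleton_prime (X_ne_zero y), ← Set.image_singleton]
  exact varIdeal_isPrime {y}

theorem prod_X_mem_iff {Y : Type*} {I : Ideal (MvPolynomial Y k)} [I.IsPrime] {e : Finset Y} :
    (∏ y ∈ e, X y) ∈ I ↔ ∃ y ∈ e, X y ∈ I :=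
  Ideal.IsPrime.prod_mem_iff

theorem varIdeal_jetSet_le_iff {s : ℕ} {V W : Set σ} :
    varIdeal k (jetSet s V) ≤ varIdeal k (jetSet s W) ↔ V ⊆ W := by
  rw [varIdeal_le_iff]
  simp only [X_mem_varIdeal, jetSet, Set.mem_ofPred_eq, Prod.forall]
  exact ⟨fun h x hx => h x 0 hx, fun h x _ hx => h hx⟩

theorem jetHom_X_coeff (s : ℕ) (x : σ) (j : Fin (s + 1)) :
    (jetHom s (X x : MvPolynomial σ k)).coeff j = X (x, j) := by
  simp only [jetHom, aeval_X, Polynomial.finsetSum_coeff, Polynomial.coeff_C_mul,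
    Polynomial.coeff_X_pow]
  simp [Fin.val_inj]

theorem jetCoeff_zero (s : ℕ) (f : MvPolynomial σ k) : jetCoeff s f 0 = jetIncl s f := by
  have h : ((Polynomial.aeval (R := MvPolynomial (JetVar σ s) k) 0).restrictScalars k).comp
      (jetHom s) = jetIncl (k := k) (X := σ) s := by
    refine algHom_ext fun x => ?_
    have := jetHom_X_coeff (k := k) s x 0
    simp only [Fin.val_zero] at this
    simp [jetIncl, ← Polynomial.coeff_zero_eq_eval_zero, this]
  rw [← h]
  simp [jetCoeff, ← Polynomial.coeff_zero_eq_eval_zero]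

theorem jetIdeal_mono {s : ℕ} {I J : Ideal (MvPolynomial σ k)} (h : I ≤ J) :
    jetIdeal s I ≤ jetIdeal s J :=
  Ideal.span_mono fun _ ⟨f, hf, j, hj⟩ => ⟨f, h hf, j, hj⟩

theorem jetIdeal_varIdeal_le (s : ℕ) (W : Set σ) :
    jetIdeal s (varIdeal k W) ≤ varIdeal k (jetSet s W) := by
  rw [varIdeal, jetIdeal_span, Ideal.span_le]
  rintro _ ⟨_, ⟨x, hx, rfl⟩, j, rfl⟩
  rw [jetCoeff, jetHom_X_coeff]
  exact X_mem_varIdeal.2 hx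

theorem comap_jetIncl_varIdeal (s : ℕ) (W : Set σ) :
    (varIdeal k (jetSet s W)).comap (jetIncl s).toRingHom = varIdeal k W := by
  apply le_antisymm
  · intro f hf
    -- Forgetting the jet index is a left inverse of `jetIncl`.
    let r : MvPolynomial (JetVar σ s) k →ₐ[k] MvPolynomial σ k := aeval fun v => X v.1
    have hr : r.comp (jetIncl s) = AlgHom.id k _ := algHom_ext fun x => by simp [r, jetIncl]
    have hle : varIdeal k (jetSet s W) ≤ (varIdeal k W).comap r := by
      rw [varIdeal_le_iff]
      intro v hv
      rw [Ideal.mem_comap, aeval_X]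
      exact X_mem_varIdeal.2 hv
    have h := hle hf
    rw [Ideal.mem_comap] at h
    change (r.comp (jetIncl s)) f ∈ _ at h
    rwa [hr] at h
  · rw [varIdeal_le_iff]
    intro x hx
    simp only [Ideal.mem_comap, AlgHom.toRingHom_eq_coe, RingHom.coe_coe, jetIncl, rename_X]
    exact X_mem_varIdeal.2 hx

/-- If a prime ideal contains the jets of `x * g` but not `g_0`, then it contains the jets of
`x`. -/
theorem X_mem_of_jetCoeff_mem {s : ℕ} {q : Ideal (MvPolynomial (JetVar σ s) k)} [hq : q.IsPrime]
    {x : σ} {g : MvPolynomial σ k} (h : ∀ j, jetCoeff s (X x * g) j ∈ q)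
    (hg : jetIncl s g ∉ q) (j : Fin (s + 1)) : X (x, j) ∈ q := by
  obtain ⟨j, hj⟩ := j
  induction j using Nat.strong_induction_on with
  | _ j ih =>
    have h1 := h ⟨j, hj⟩
    -- Isolate `x_j * g_0`; every other term contains some `x_i` with `i < j`.
    rw [jetCoeff, map_mul, Polynomial.coeff_mul, ← Finset.add_sum_erase _ _
      (Finset.HasAntidiagonal.mem_antidiagonal.2 (add_zero j) : (j, 0) ∈ Finset.HasAntidiagonal.antidiagonal j)] at h1
    rw [Ideal.add_mem_iff_left] at h1
    · simp only [jetHom_X_coeff s x ⟨j, hj⟩] at h1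
      refine (hq.mem_or_mem h1).resolve_right ?_
      rw [← jetCoeff_zero] at hg
      exact hg
    · refine Ideal.sum_mem _ fun p hp => Ideal.mul_mem_right _ _ ?_
      simp only [Finset.mem_erase, Finset.HasAntidiagonal.mem_antidiagonal, ne_eq, Prod.ext_iff] at hp
      have hlt : p.1 < j := by omega
      rw [show p.1 = ((⟨p.1, hlt.trans hj⟩ : Fin (s + 1)) : ℕ) from rfl, jetHom_X_coeff]
      exact ih _ hlt _

end Jets

/-! ### Finite intersections of incomparable primes. -/

section PrimaryDecomposition

variable {R : Type*} [CommRing R] {ι : Type*} [Finite ι] {q : ι → Ideal R}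

/-- In a family of pairwise incomparable prime ideals none contains the intersection of the
others. -/
theorem exists_notMem_forall_ne_mem_of_isPrime (hq : ∀ i, (q i).IsPrime)
    (hanti : ∀ i j, q i ≤ q j → i = j) (i : ι) : ∃ y ∉ q i, ∀ j, j ≠ i → y ∈ q j := by
  classical
  cases nonempty_fintype ι
  by_contra! h
  have hle : (Finset.univ.erase i).inf q ≤ q i := by
    intro y hy
    by_contra hyi
    obtain ⟨j, hj, hyj⟩ := h y hyi
    exact hyj ((Finset.inf_le (Finset.mem_erase.2 ⟨hj, Finset.mem_univ j⟩) :
      (Finset.univ.erase i).inf q ≤ q j) hy)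
  obtain ⟨j, hj, hji⟩ := (Ideal.IsPrime.inf_le' (hq i)).1 hle
  exact (Finset.mem_erase.1 hj).1 (hanti _ _ hji)

theorem isMinimalPrimaryDecomposition_range_of_isPrime (hq : ∀ i, (q i).IsPrime)
    (hanti : ∀ i j, q i ≤ q j → i = j) :
    Submodule.IsMinimalPrimaryDecomposition (⨅ i, q i) (Set.finite_range q).toFinset where
  inf_eq := by
    rw [Finset.inf_id_eq_sInf, Set.Finite.coe_toFinset, sInf_range]
  primary := by
    intro J hJ
    obtain ⟨i, rfl⟩ := (Set.Finite.mem_toFinset _).1 hJ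
    exact (hq i).isPrimary
  distinct := by
    intro J hJ J' hJ' hne
    obtain ⟨i, rfl⟩ := (Set.Finite.mem_toFinset _).1 hJ
    obtain ⟨j, rfl⟩ := (Set.Finite.mem_toFinset _).1 hJ'
    simpa [Function.onFun, (hq i).radical, (hq j).radical] using hne
  minimal := by
    intro J hJ hle
    obtain ⟨i, rfl⟩ := (Set.Finite.mem_toFinset _).1 hJ
    obtain ⟨y, hy, hy'⟩ := exists_notMem_forall_ne_mem_of_isPrime hq hanti i
    refine hy (hle ?_)
    simp only [Submodule.mem_finsetInf, Finset.mem_erase, Set.Finite.mem_toFinset, id]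
    rintro _ ⟨hne, j, rfl⟩
    exact hy' j fun h => hne (h ▸ rfl)

theorem Submodule.IsMinimalPrimaryDecomposition.eq_range_of_isPrime (hq : ∀ i, (q i).IsPrime)
    (hanti : ∀ i j, q i ≤ q j → i = j) {t : Finset (Ideal R)}
    (ht : Submodule.IsMinimalPrimaryDecomposition (⨅ i, q i) t) :
    t = (Set.finite_range q).toFinset := by
  classical
  cases nonempty_fintype ι
  have hle : ∀ J ∈ t, ⨅ i, q i ≤ J := fun J hJ => by
    rw [← ht.inf_eq]
    exact Finset.inf_le hJ
  have hmem : ∀ i, q i ∈ t := by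
    intro i
    have h1 : t.inf id ≤ q i := ht.inf_eq ▸ iInf_le q i
    obtain ⟨J, hJ, hJi⟩ := (Ideal.IsPrime.inf_le' (hq i)).1 h1
    have hprim : J.IsPrimary := ht.primary hJ
    have hprime := Ideal.isPrime_radical hprim
    have h2 : Finset.univ.inf q ≤ J.radical := by
      rw [Finset.inf_univ_eq_iInf]
      exact (hle J hJ).trans Ideal.le_radical
    obtain ⟨j, -, hj⟩ := (Ideal.IsPrime.inf_le' hprime).1 h2
    have hrad : J.radical ≤ q i := (hq i).radical_le_iff.2 hJi
    obtain ⟨y, hy, hy'⟩ := exists_notMem_forall_ne_mem_of_isPrime hq hanti i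
    suffices q i ≤ J by rwa [le_antisymm this hJi]
    intro x hx
    -- `y` lies in every prime except `q i`, hence outside the radical of `J`, so it can be
    -- cancelled.
    have hxy : x * y ∈ J := hle J hJ <| (Submodule.mem_iInf _).2 fun l => by
      by_cases hl : l = i
      · exact hl ▸ Ideal.mul_mem_right _ _ hx
      · exact Ideal.mul_mem_left _ _ (hy' l hl)
    exact ((Ideal.isPrimary_iff.1 hprim).2 hxy).resolve_right fun h => hy (hrad h)
  ext J
  rw [Set.Finite.mem_toFinset]
  refine ⟨fun hJ => ?_, ?_⟩
  · by_contra hJr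
    -- All the `q i` already occur among the other components, so `J` would be redundant.
    refine ht.minimal hJ (le_trans (le_iInf fun i => ?_) (hle J hJ))
    exact Finset.inf_le (f := id) (Finset.mem_erase.2 ⟨fun h => hJr ⟨i, h⟩, hmem i⟩)
  · rintro ⟨i, rfl⟩
    exact hmem i

end PrimaryDecomposition

/-! ### Smoothness at a point as a lifting property. -/

/-- If the localization of `A` at `p` is formally smooth, then morphisms out of `A` sending the
complement of `p` to units lift along surjections with nilpotent kernel. -/
theorem Algebra.IsSmoothAt.exists_lift {k A B C : Type*} [CommRing k] [CommRing A] [CommRing B]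
    [CommRing C] [Algebra k A] [Algebra k B] [Algebra k C] {p : Ideal A} [p.IsPrime]
    (hp : Algebra.IsSmoothAt k p) (g : A →ₐ[k] C) (hg : ∀ a ∉ p, IsUnit (g a)) (π : B →ₐ[k] C)
    (hπ : Function.Surjective π) (hker : IsNilpotent (RingHom.ker (π : B →+* C))) :
    ∃ h : A →ₐ[k] B, π.comp h = g := by
  let g' : Localization.AtPrime p →ₐ[k] C :=
    IsLocalization.liftAlgHom (M := p.primeCompl) (f := g) fun a => hg a a.2
  refine ⟨(Algebra.FormallySmooth.liftOfSurjective g' π hπ hker).comp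
    (IsScalarTower.toAlgHom k A _), AlgHom.ext fun a => ?_⟩
  have := Algebra.FormallySmooth.liftOfSurjective_apply g' π hπ hker (algebraMap A _ a)
  simpa [g'] using this

/-- The localization of `A` at `p` is formally smooth if every morphism from it to a quotient by a
square-zero ideal lifts on `A`. -/
theorem Algebra.IsSmoothAt.of_exists_lift {k : Type u} {A : Type v} [CommRing k] [CommRing A]
    [Algebra k A] {p : Ideal A} [p.IsPrime]
    (H : ∀ ⦃B : Type max u v⦄ [CommRing B] [Algebra k B] (N : Ideal B) (_ : N ^ 2 = ⊥)
      (g : Localization.AtPrime p →ₐ[k] B ⧸ N), ∃ h : A →ₐ[k] B,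
        (Ideal.Quotient.mkₐ k N).comp h = g.comp (IsScalarTower.toAlgHom k A _)) :
    Algebra.IsSmoothAt k p := by
  refine Algebra.FormallySmooth.of_comp_surjective fun B _ _ N hN g => ?_
  obtain ⟨h, hh⟩ := H N hN g
  -- Units lift modulo a nilpotent ideal, so `h` extends to the localization.
  have hu : ∀ a : p.primeCompl, IsUnit (h a) := by
    intro a
    have h1 : IsUnit (Ideal.Quotient.mk N (h a)) := by
      have := DFunLike.congr_fun hh (a : A)
      simp only [AlgHom.comp_apply, Ideal.Quotient.mkₐ_eq_mk, IsScalarTower.coe_toAlgHom'] at this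
      rw [this]
      exact (IsLocalization.map_units _ a).map g
    exact (IsNilpotent.isUnit_quotient_mk_iff ⟨2, hN⟩).1 h1
  refine ⟨IsLocalization.liftAlgHom (M := p.primeCompl) (f := h) hu, ?_⟩
  refine AlgHom.coe_ringHom_injective (IsLocalization.ringHom_ext p.primeCompl ?_)
  ext a
  simpa using DFunLike.congr_fun hh a

/-! ### Smoothness at generic points of coordinate subspaces. -/

namespace Jets

variable {σ : Type*} {k : Type*} [Field k]

/-- The generic point of a linear subspace is smooth if the subspace is, generically, all of the
subscheme. -/
theorem varIdeal_mem_smoothPoints {W : Set σ} {I : Ideal (MvPolynomial σ k)}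
    (hI : I ≤ varIdeal k W) (hW : ∀ x ∈ W, ∃ u ∉ varIdeal k W, u * X x ∈ I) :
    (⟨varIdeal k W, inferInstance⟩ : PrimeSpectrum (MvPolynomial σ k)) ∈ smoothPoints I := by
  classical
  have hker : RingHom.ker (Ideal.Quotient.mk I) ≤ varIdeal k W := by rwa [Ideal.mk_ker]
  have hsurj := Ideal.Quotient.mk_surjective (I := I)
  set p : Ideal (MvPolynomial σ k ⧸ I) := (varIdeal k W).map (Ideal.Quotient.mk I) with hp
  have hprime : p.IsPrime := Ideal.map_isPrime_of_surjective hsurj hker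
  have hcomap : p.comap (Ideal.Quotient.mk I) = varIdeal k W := by
    rw [hp, Ideal.comap_map_of_surjective' _ hsurj, sup_eq_left.2 hker]
  refine ⟨⟨p, hprime⟩, Algebra.IsSmoothAt.of_exists_lift fun B _ _ N hN g => ?_,
    PrimeSpectrum.ext hcomap⟩
  have hx : ∀ x ∈ W, algebraMap _ (Localization.AtPrime p) (Ideal.Quotient.mk I (X x)) = 0 := by
    intro x hx
    obtain ⟨u, hu, hux⟩ := hW x hx
    have hu' : Ideal.Quotient.mk I u ∉ p := fun h => hu (hcomap ▸ h)
    have h0 := congrArg (algebraMap _ (Localization.AtPrime p))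
      (Ideal.Quotient.eq_zero_iff_mem.2 hux)
    rw [map_mul, map_mul, map_zero] at h0
    exact (IsLocalization.map_units (Localization.AtPrime p)
      (⟨_, hu'⟩ : p.primeCompl)).mul_right_eq_zero.1 h0
  choose c hc using fun x : σ => Ideal.Quotient.mk_surjective (I := N)
    (g (algebraMap _ (Localization.AtPrime p) (Ideal.Quotient.mk I (X x))))
  -- Variables outside `W` may be lifted arbitrarily; those in `W` must go to zero in order to kill
  -- `I`.
  let h : MvPolynomial σ k →ₐ[k] B := aeval fun x => if x ∈ W then 0 else c x
  have hle : varIdeal k W ≤ RingHom.ker h := by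
    rw [varIdeal_le_iff]
    intro x hx
    simp [h, hx]
  refine ⟨Ideal.Quotient.liftₐ I h fun a ha => hle (hI ha), ?_⟩
  refine Ideal.Quotient.algHom_ext _ (algHom_ext fun x => ?_)
  have hlift : Ideal.Quotient.liftₐ I h (fun a ha => hle (hI ha)) (Ideal.Quotient.mk I (X x)) =
      h (X x) := Ideal.Quotient.lift_mk I _ _
  simp only [AlgHom.comp_apply, Ideal.Quotient.mkₐ_eq_mk, hlift, IsScalarTower.coe_toAlgHom']
  by_cases hxW : x ∈ W
  · simp [h, hxW, hx x hxW]
  · simp [h, hxW, hc]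

end Jets

/-! ### Smooth points of the zero locus of an edge ideal. -/

namespace Clutter

variable {σ : Type*} {k : Type*} [Field k] {C : Clutter σ}

theorem prod_X_mem_edgeIdeal {e : Finset σ} (he : e ∈ C.edges) :
    (∏ x ∈ e, X x) ∈ C.edgeIdeal k :=
  Ideal.subset_span ⟨e, he, rfl⟩

theorem edgeIdeal_le_varIdeal {W : Set σ} (hW : C.IsVertexCover W) :
    C.edgeIdeal k ≤ Jets.varIdeal k W := by
  refine Ideal.span_le.2 ?_
  rintro _ ⟨e, he, rfl⟩
  obtain ⟨x, hx, hxW⟩ := hW e he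
  exact Jets.prod_X_mem_iff.2 ⟨x, hx, Jets.X_mem_varIdeal.2 hxW⟩

/-- Otherwise `W` without `x` would still be a cover. -/
theorem IsMinimalVertexCover.exists_edge {W : Set σ} (hW : C.IsMinimalVertexCover W) {x : σ}
    (hx : x ∈ W) : ∃ e ∈ C.edges, x ∈ e ∧ ∀ y ∈ e, y ∈ W → y = x := by
  by_contra! h
  have hcover : C.IsVertexCover (W \ {x}) := by
    intro e he
    by_cases hxe : x ∈ e
    · obtain ⟨y, hy, hyW, hyx⟩ := h e he hxe
      exact ⟨y, hy, hyW, hyx⟩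
    · obtain ⟨y, hy, hyW⟩ := hW.1 e he
      exact ⟨y, hy, hyW, fun hyx => hxe (hyx ▸ hy)⟩
  exact (hW.2 hcover Set.sdiff_subset hx).2 rfl

/-- If `e ∩ V` is minimal among the intersections of edges with `V`, the product of its variables
divides the image of the edge ideal, and of its radical, under any substitution which is zero
on the rest of `V`. -/
theorem prod_X_dvd_of_mem_radical {K : Type*} [Field K] [Algebra k K] {V : Set σ} {S : Finset σ}
    (hmin : ∀ e ∈ C.edges, (∀ x ∈ e, x ∈ V → x ∈ S) → S ⊆ e)
    (ψ : MvPolynomial σ k →ₐ[k] MvPolynomial σ K) (hS : ∀ x ∈ S, ψ (X x) = X x)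
    (hV : ∀ x ∈ V, x ∉ S → ψ (X x) = 0) {f : MvPolynomial σ k}
    (hf : f ∈ (C.edgeIdeal k).radical) : ∏ x ∈ S, X x ∣ ψ f := by
  have hle : C.edgeIdeal k ≤ (Ideal.span {∏ x ∈ S, (X x : MvPolynomial σ K)}).comap ψ := by
    refine Ideal.span_le.2 ?_
    rintro _ ⟨e, he, rfl⟩
    simp only [SetLike.mem_coe, Ideal.mem_comap, Ideal.mem_span_singleton, map_prod]
    by_cases h : ∀ x ∈ e, x ∈ V → x ∈ S
    · rw [← Finset.prod_congr rfl hS]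
      exact Finset.prod_dvd_prod_of_subset _ _ _ (hmin e he h)
    · push Not at h
      obtain ⟨x, hx, hxV, hxS⟩ := h
      rw [Finset.prod_eq_zero hx (hV x hxV hxS)]
      exact dvd_zero _
  obtain ⟨n, hn⟩ := hf
  have h1 := hle hn
  rw [Ideal.mem_comap, Ideal.mem_span_singleton, map_pow] at h1
  -- The product is squarefree, so dividing a power of `ψ f` is enough.
  refine Finset.prod_dvd_of_isRelPrime (fun x _ y _ hxy => ?_) fun x hx =>
    (Jets.prime_X x).dvd_of_dvd_pow ((Finset.dvd_prod_of_mem _ hx).trans h1)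
  rw [Function.onFun, (Jets.prime_X x).irreducible.isRelPrime_iff_not_dvd, X_dvd_X]
  exact hxy

/-- At a smooth point `p` of the vanishing locus of the edge ideal, if `e ∩ V` is minimal among the
intersections of edges with `V = {x | x ∈ p}`, then it has at most one element. -/
theorem card_le_one_of_mem_smoothPoints {p : PrimeSpectrum (MvPolynomial σ k)}
    (hp : p ∈ Jets.smoothPoints (C.edgeIdeal k).radical) {e S : Finset σ} (he : e ∈ C.edges)
    (hSe : ∀ x, x ∈ S ↔ x ∈ e ∧ X x ∈ p.asIdeal)
    (hmin : ∀ e ∈ C.edges, (∀ x ∈ e, X x ∈ p.asIdeal → x ∈ S) → S ⊆ e) : S.card ≤ 1 := by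
  classical
  by_contra! hcard
  set I := (C.edgeIdeal k).radical
  set d := S.card
  let K := p.asIdeal.ResidueField
  let φ : MvPolynomial σ k →ₐ[k] K := IsScalarTower.toAlgHom k (MvPolynomial σ k) K
  have hφ : ∀ f, φ f = 0 ↔ f ∈ p.asIdeal := fun f => Ideal.algebraMap_residueField_eq_zero
  -- The variables of `S` are kept distinct until `τ` merges them: for `f` in the radical, `t ^ d ∣
  -- f ^ n` in one variable would not give `t ^ d ∣ f`.
  let ψ₀ : MvPolynomial σ k →ₐ[k] MvPolynomial σ K :=
    aeval fun x => if x ∈ S then X x else MvPolynomial.C (φ (X x))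
  let τ : MvPolynomial σ K →ₐ[K] Polynomial K := aeval fun _ => Polynomial.X
  let ψ : MvPolynomial σ k →ₐ[k] Polynomial K := (τ.restrictScalars k).comp ψ₀
  have hψS : ∀ x ∈ S, ψ (X x) = Polynomial.X := fun x hx => by simp [ψ, ψ₀, τ, hx]
  have hψS' : ∀ x ∉ S, ψ (X x) = Polynomial.C (φ (X x)) := fun x hx => by
    simp [ψ, ψ₀, τ, hx]
  have hψI : ∀ f ∈ I, Polynomial.X ^ d ∣ ψ f := by
    intro f hf
    have h := prod_X_dvd_of_mem_radical (V := {x | X x ∈ p.asIdeal}) hmin ψ₀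
      (fun x hx => by simp [ψ₀, hx])
      (fun x hx hxS => by simp [ψ₀, hxS, (hφ (X x)).2 hx]) hf
    have h' := map_dvd τ h
    rw [map_prod, Finset.prod_congr rfl (fun x _ => show τ (X x) = Polynomial.X by simp [τ]),
      Finset.prod_const] at h'
    exact h'
  have hψ0 : ∀ f, (ψ f).eval 0 = φ f := by
    intro f
    have h : ((Polynomial.aeval (R := K) (0 : K)).restrictScalars k).comp ψ = φ := by
      refine algHom_ext fun x => ?_
      by_cases hx : x ∈ S
      · have : φ (X x) = 0 := (hφ _).2 ((hSe x).1 hx).2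
        simp [hψS x hx, this]
      · simp [hψS' x hx]
    rw [← h]
    simp [Polynomial.coe_aeval_eq_eval]
  let Q := fun n : ℕ => Ideal.span {(Polynomial.X : Polynomial K) ^ n}
  have hQ : ∀ n f, Ideal.Quotient.mk (Q n) f = 0 ↔ Polynomial.X ^ n ∣ f := fun n f => by
    rw [Ideal.Quotient.eq_zero_iff_mem, Ideal.mem_span_singleton]
  have hQle : Q (d + 1) ≤ Q d := by
    rw [Ideal.span_singleton_le_span_singleton]
    exact pow_dvd_pow _ d.le_succ
  let π : (Polynomial K ⧸ Q (d + 1)) →ₐ[k] (Polynomial K ⧸ Q d) :=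
    Ideal.Quotient.factorₐ k hQle
  have hπmk : ∀ f, π (Ideal.Quotient.mk _ f) = Ideal.Quotient.mk _ f := fun f => rfl
  have hπ : Function.Surjective π := Ideal.Quotient.factor_surjective hQle
  have hker : IsNilpotent (RingHom.ker (π : (Polynomial K ⧸ Q (d + 1)) →+* (Polynomial K ⧸ Q d))) := by
    have hnil : ∀ J : Ideal (Polynomial K ⧸ Q (d + 1)),
        (∀ a ∈ J, ∀ b ∈ J, a * b ∈ (⊥ : Ideal (Polynomial K ⧸ Q (d + 1)))) → IsNilpotent J :=
      fun J hJ => ⟨2, (pow_two J).trans (le_bot_iff.1 (Ideal.mul_le.2 hJ))⟩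
    refine hnil _ fun a ha b hb => ?_
    obtain ⟨a, rfl⟩ := Ideal.Quotient.mk_surjective a
    obtain ⟨b, rfl⟩ := Ideal.Quotient.mk_surjective b
    have ha' : Polynomial.X ^ d ∣ a := (hQ d a).1 ha
    have hb' : Polynomial.X ^ d ∣ b := (hQ d b).1 hb
    rw [Ideal.mem_bot, ← map_mul, hQ]
    refine (pow_dvd_pow _ (by omega : d + 1 ≤ d + d)).trans ?_
    rw [pow_add]
    exact mul_dvd_mul ha' hb'
  obtain ⟨P, hP, hPp⟩ := hp
  have hmem : ∀ f, Ideal.Quotient.mk I f ∈ P.asIdeal ↔ f ∈ p.asIdeal := fun f => by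
    rw [← hPp]
    rfl
  let g : (MvPolynomial σ k ⧸ I) →ₐ[k] (Polynomial K ⧸ Q d) :=
    Ideal.Quotient.liftₐ I ((Ideal.Quotient.mkₐ k (Q d)).comp ψ) fun f hf =>
      (hQ d _).2 (hψI f hf)
  have hg : ∀ f, g (Ideal.Quotient.mk I f) = Ideal.Quotient.mk (Q d) (ψ f) := fun f => rfl
  have hgu : ∀ a ∉ P.asIdeal, IsUnit (g a) := by
    intro a ha
    obtain ⟨f, rfl⟩ := Ideal.Quotient.mk_surjective a
    -- Outside `p` the constant term is nonzero, so `ψ f` is coprime to `t ^ d`.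
    rw [hmem, ← hφ, ← hψ0, ← Polynomial.IsRoot.def, ← Polynomial.dvd_iff_isRoot, map_zero,
      sub_zero] at ha
    obtain ⟨u, v, huv⟩ := ((Polynomial.prime_X.irreducible.coprime_iff_not_dvd).2 ha).pow_left
      (m := d)
    have h := congrArg (Ideal.Quotient.mk (Q d)) huv
    rw [map_add, map_mul, (hQ d _).2 dvd_rfl, mul_zero, zero_add, map_mul, map_one] at h
    rw [hg]
    exact IsUnit.of_mul_eq_one_right _ h
  obtain ⟨h, hh⟩ := Algebra.IsSmoothAt.exists_lift hP g hgu π hπ hker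
  choose r hr using fun x : σ => Ideal.Quotient.mk_surjective (h (Ideal.Quotient.mk I (X x)))
  have hrψ : ∀ x, Polynomial.X ^ d ∣ r x - ψ (X x) := by
    intro x
    rw [← hQ, map_sub, ← hπmk, hr, ← hg, ← hh]
    exact sub_self _
  have hdvd : Polynomial.X ^ (d + 1) ∣ ∏ x ∈ e, r x := by
    rw [← hQ, map_prod, Finset.prod_congr rfl fun x _ => hr x, ← map_prod, ← map_prod,
      Ideal.Quotient.eq_zero_iff_mem.2 (Ideal.le_radical (prod_X_mem_edgeIdeal he)), map_zero]
  choose c hc using hrψ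
  -- As `d ≥ 2`, the second factor has constant term `1`. After cancelling `t ^ d`, no remaining
  -- factor is divisible by `t`: for `x` in `e` outside `S` the constant term is the nonzero residue
  -- of `x`.
  have hrS : ∀ x ∈ S, r x = Polynomial.X * (1 + Polynomial.X ^ (d - 1) * c x) := by
    intro x hx
    have h1 := hc x
    rw [hψS x hx, sub_eq_iff_eq_add] at h1
    rw [h1, ← Nat.sub_add_cancel (by omega : 1 ≤ d), Nat.add_sub_cancel]
    ring
  have hSsub : S ⊆ e := fun x hx => ((hSe x).1 hx).1
  rw [← Finset.prod_sdiff hSsub, Finset.prod_congr rfl hrS, Finset.prod_mul_distrib,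
    Finset.prod_const, pow_succ, mul_left_comm] at hdvd
  have hdvd' := (mul_dvd_mul_iff_left (pow_ne_zero d Polynomial.X_ne_zero)).1 hdvd
  have heval : ∀ f : Polynomial K, Polynomial.X ∣ f ↔ f.eval 0 = 0 := fun f => by
    rw [← Polynomial.IsRoot.def, ← Polynomial.dvd_iff_isRoot, map_zero, sub_zero]
  rcases Polynomial.prime_X.dvd_or_dvd hdvd' with h1 | h1
  · obtain ⟨x, hx, hxr⟩ := (Polynomial.prime_X.dvd_finsetProd_iff _).1 h1
    rw [Finset.mem_sdiff] at hx
    have h2 := hc x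
    rw [hψS' x hx.2, sub_eq_iff_eq_add] at h2
    rw [heval, h2] at hxr
    simp only [Polynomial.eval_add, Polynomial.eval_mul, Polynomial.eval_pow, Polynomial.eval_X,
      zero_pow (by omega : d ≠ 0), zero_mul, zero_add, Polynomial.eval_C] at hxr
    exact hx.2 ((hSe x).2 ⟨hx.1, (hφ _).1 hxr⟩)
  · obtain ⟨x, hx, hxr⟩ := (Polynomial.prime_X.dvd_finsetProd_iff _).1 h1
    rw [heval] at hxr
    simp [zero_pow (by omega : d - 1 ≠ 0)] at hxr

/-- At a smooth point `p` of the vanishing locus of the edge ideal, every edge contains, among the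
vertices in `p`, those of an edge with exactly one vertex in `p`. -/
theorem exists_edge_of_mem_smoothPoints {p : PrimeSpectrum (MvPolynomial σ k)}
    (hp : p ∈ Jets.smoothPoints (C.edgeIdeal k).radical) (hle : C.edgeIdeal k ≤ p.asIdeal)
    {e : Finset σ} (he : e ∈ C.edges) :
    ∃ x ∈ e, ∃ e' ∈ C.edges, x ∈ e' ∧ X x ∈ p.asIdeal ∧ ∀ y ∈ e', X y ∈ p.asIdeal → y = x := by
  classical
  induction hn : (e.filter fun x => X x ∈ p.asIdeal).card using Nat.strong_induction_on
    generalizing e with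
  | _ n ih =>
    subst hn
    by_cases h : ∀ e' ∈ C.edges, (∀ x ∈ e', X x ∈ p.asIdeal →
      x ∈ e.filter fun x => X x ∈ p.asIdeal) → (e.filter fun x => X x ∈ p.asIdeal) ⊆ e'
    · have hcard := card_le_one_of_mem_smoothPoints hp he (fun x => Finset.mem_filter) h
      obtain ⟨x, hx, hxp⟩ := Jets.prod_X_mem_iff.1 (hle (prod_X_mem_edgeIdeal he))
      refine ⟨x, hx, e, he, hx, hxp, fun y hy hyp => ?_⟩
      exact Finset.card_le_one.1 hcard _ (Finset.mem_filter.2 ⟨hy, hyp⟩) _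
        (Finset.mem_filter.2 ⟨hx, hxp⟩)
    · push Not at h
      obtain ⟨e', he', hsub, hnot⟩ := h
      -- The trace of `e'` on `p` is strictly smaller than that of `e`.
      obtain ⟨x, hx, e'', he'', hx'', hxp, huniq⟩ := ih _ (Finset.card_lt_card (by
        refine Finset.ssubset_iff_subset_ne.2 ⟨fun x hx => ?_, fun heq => hnot ?_⟩
        · exact hsub x (Finset.mem_filter.1 hx).1 (Finset.mem_filter.1 hx).2
        · rw [← heq]
          exact Finset.filter_subset _ _)) he' rfl
      exact ⟨x, (Finset.mem_filter.1 (hsub x hx hxp)).1, e'', he'', hx'', hxp, huniq⟩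

/-- At a smooth point `p` of the vanishing locus of the edge ideal, the vertices in `p` contain
a minimal vertex cover consisting of vertices which are alone in `p` within some edge. -/
theorem exists_isMinimalVertexCover_of_mem_smoothPoints {p : PrimeSpectrum (MvPolynomial σ k)}
    (hp : p ∈ Jets.smoothPoints (C.edgeIdeal k).radical) (hle : C.edgeIdeal k ≤ p.asIdeal) :
    ∃ W, C.IsMinimalVertexCover W ∧
      ∀ x ∈ W, ∃ e ∈ C.edges, x ∈ e ∧ ∀ y ∈ e, X y ∈ p.asIdeal → y = x := by
  refine ⟨{x | ∃ e ∈ C.edges, x ∈ e ∧ X x ∈ p.asIdeal ∧ ∀ y ∈ e, X y ∈ p.asIdeal → y = x},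
    ⟨fun e he => ?_, fun U hU hUW x hx => ?_⟩, fun x hx => ?_⟩
  · obtain ⟨x, hx, e', he', h⟩ := exists_edge_of_mem_smoothPoints hp hle he
    exact ⟨x, hx, e', he', h⟩
  · obtain ⟨e, he, hxe, hxp, huniq⟩ := hx
    obtain ⟨y, hy, hyU⟩ := hU e he
    obtain ⟨_, _, _, hyp, _⟩ := hUW hyU
    exact huniq y hy hyp ▸ hyU
  · obtain ⟨e, he, hxe, hxp, huniq⟩ := hx
    exact ⟨e, he, hxe, huniq⟩

/-! ### Principal jets of edge ideals and their decomposition. -/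

/-- The ideal of principal jets of an edge ideal is the intersection of the ideals of jets of the
minimal vertex covers. -/
theorem principalJetIdeal_edgeIdeal (C : Clutter σ) (s : ℕ) :
    Jets.principalJetIdeal s (C.edgeIdeal k) =
      ⨅ W ∈ {W | C.IsMinimalVertexCover W}, Jets.varIdeal k (Jets.jetSet s W) := by
  classical
  rw [Jets.principalJetIdeal, PrimeSpectrum.vanishingIdeal_closure, Jets.singularLocus,
    Jets.jetLocus, PrimeSpectrum.vanishingIdeal_zeroLocus_eq_radical]
  apply le_antisymm
  · refine le_iInf₂ fun W hW f hf => ?_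
    let q : PrimeSpectrum (MvPolynomial (Jets.JetVar σ s) k) :=
      ⟨Jets.varIdeal k (Jets.jetSet s W), inferInstance⟩
    have hproj : Jets.jetProj s q = ⟨Jets.varIdeal k W, inferInstance⟩ :=
      PrimeSpectrum.ext (Jets.comap_jetIncl_varIdeal s W)
    have hle : (C.edgeIdeal k).radical ≤ Jets.varIdeal k W :=
      (Jets.varIdeal_isPrime W).radical_le_iff.2 (edgeIdeal_le_varIdeal hW.1)
    refine (PrimeSpectrum.mem_vanishingIdeal _ _).1 hf q ⟨?_, fun h => h.2 ?_⟩
    · exact (Jets.jetIdeal_mono hle).trans (Jets.jetIdeal_varIdeal_le s W)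
    · rw [hproj]
      refine Jets.varIdeal_mem_smoothPoints hle fun x hx => ?_
      obtain ⟨e, he, hxe, huniq⟩ := hW.exists_edge hx
      refine ⟨∏ y ∈ e.erase x, X y, fun h => ?_, ?_⟩
      · obtain ⟨y, hy, hyW⟩ := Jets.prod_X_mem_iff.1 h
        rw [Finset.mem_erase] at hy
        exact hy.1 (huniq y hy.2 (Jets.X_mem_varIdeal.1 hyW))
      · rw [Finset.prod_erase_mul _ _ hxe]
        exact Ideal.le_radical (prod_X_mem_edgeIdeal he)
  · intro f hf
    rw [PrimeSpectrum.mem_vanishingIdeal]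
    rintro q ⟨hqjet, hqsing⟩
    have hjet : ∀ g ∈ C.edgeIdeal k, ∀ j, Jets.jetCoeff s g j ∈ q.asIdeal := fun g hg j =>
      hqjet (Ideal.subset_span ⟨g, Ideal.le_radical hg, j, rfl⟩)
    -- The coefficients of `t ^ 0` show that `q` lies over `Z`.
    have hle : C.edgeIdeal k ≤ (Jets.jetProj s q).asIdeal := fun g hg => by
      have := hjet g hg 0
      rwa [Jets.jetCoeff_zero] at this
    have hsmooth : Jets.jetProj s q ∈ Jets.smoothPoints (C.edgeIdeal k).radical := by
      by_contra h
      exact hqsing ⟨hle, h⟩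
    obtain ⟨W, hW, hWe⟩ := exists_isMinimalVertexCover_of_mem_smoothPoints hsmooth hle
    suffices Jets.varIdeal k (Jets.jetSet s W) ≤ q.asIdeal from
      this (Submodule.mem_iInf _ |>.1 (Submodule.mem_iInf _ |>.1 hf W) hW)
    rw [Jets.varIdeal_le_iff]
    rintro ⟨x, j⟩ hx
    obtain ⟨e, he, hxe, huniq⟩ := hWe x hx
    refine Jets.X_mem_of_jetCoeff_mem (g := ∏ y ∈ e.erase x, X y) (fun j => ?_) (fun h => ?_) j
    · rw [Finset.mul_prod_erase _ _ hxe]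
      exact hjet _ (prod_X_mem_edgeIdeal he) j
    · have h' : (∏ y ∈ e.erase x, X y) ∈ (Jets.jetProj s q).asIdeal := h
      obtain ⟨y, hy, hyp⟩ := Jets.prod_X_mem_iff.1 h'
      rw [Finset.mem_erase] at hy
      exact hy.1 (huniq y hy.2 hyp)

end Clutter

end

theorem mainTheorem4 {X : Type*} [Finite X] {k : Type*} [Field k] (C : Clutter X)
    (n : ℕ) (W : Fin n → Set X) (hW : Function.Injective W)
    (hrange : Set.range W = {V | C.IsMinimalVertexCover V}) (s : ℕ) :
    Jets.principalJetIdeal s (C.edgeIdeal k) =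
        ⨅ i : Fin n, Jets.varIdeal k (Jets.jetSet s (W i)) ∧
      Function.Injective (fun i : Fin n => Jets.varIdeal k (Jets.jetSet s (W i))) ∧
      Submodule.IsMinimalPrimaryDecomposition (Jets.principalJetIdeal s (C.edgeIdeal k))
        (Set.finite_range fun i : Fin n => Jets.varIdeal k (Jets.jetSet s (W i))).toFinset ∧
      ∀ t : Finset (Ideal (MvPolynomial (Jets.JetVar X s) k)),
        Submodule.IsMinimalPrimaryDecomposition (Jets.principalJetIdeal s (C.edgeIdeal k)) t →
          t = (Set.finite_range fun i : Fin n =>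
            Jets.varIdeal k (Jets.jetSet s (W i))).toFinset := by
  have heq : Jets.principalJetIdeal s (C.edgeIdeal k) =
      ⨅ i : Fin n, Jets.varIdeal k (Jets.jetSet s (W i)) := by
    rw [C.principalJetIdeal_edgeIdeal, ← hrange, iInf_range]
  have hmin : ∀ i, C.IsMinimalVertexCover (W i) := fun i =>
    hrange.subset (Set.mem_range_self i)
  have hanti : ∀ i j : Fin n, Jets.varIdeal k (Jets.jetSet s (W i)) ≤
      Jets.varIdeal k (Jets.jetSet s (W j)) → i = j := fun i j hij => by
    have hsub := Jets.varIdeal_jetSet_le_iff.1 hij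
    exact hW (hsub.antisymm ((hmin j).2 (hmin i).1 hsub))
  have hprime : ∀ i : Fin n, (Jets.varIdeal k (Jets.jetSet s (W i))).IsPrime :=
    fun _ => inferInstance
  refine ⟨heq, fun i j hij => hanti i j hij.le, ?_, fun t ht => ?_⟩
  · rw [heq]
    exact isMinimalPrimaryDecomposition_range_of_isPrime hprime hanti
  · rw [heq] at ht
    exact ht.eq_range_of_isPrime hprime hanti
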